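/- Let $\mu\ge 3$ be an integer, $\varpi=2\cos(\pi/\mu)$, $q=e^{2\pi i z/\varpi}$ and $\theta=q\,\frac{d}{dq}=\frac{\varpi}{2\pi i}\frac{d}{dz}$ for $z\in\mathbb H$. Let $\mathfrak H(\varpi)$ be the Hecke triangle group of signature $(2,\mu,\infty)$, generated by $z\mapsto -1/z$ and $z\mapsto z+\varpi$, and let $\mathcal M_k$ be its space of automorphic forms of weight $k$ (holomorphic on $\mathbb H$ and at the cusps). Put $a=\frac{\mu+2}{4\mu}$, $b=\frac{\mu-2}{4\mu}$, $c=\frac{3\mu-2}{4\mu}$, and let $y_1,y_2,y_3$ be meromorphic functions on $\mathbb H$ that solve the Darboux–Halphen system $$\begin{aligned}\theta y_1&=(a-1)(y_1y_2+y_1y_3-y_2y_3)+(b+c-1)y_1^2,\\ \theta y_2&=(b-1)(y_2y_1+y_2y_3-y_1y_3)+(a+c-1)y_2^2,\\ \theta y_3&=(c-1)(y_3y_1+y_3y_2-y_1y_2)+(a+b-1)y_3^2,\end{aligned}$$ normalized so that $J=\frac{y_3-y_2}{y_3-y_1}$ is the hauptmodul of $\mathfrak H(\varpi)$, i.e. $J$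 is $\mathfrak H(\varpi)$-invariant with $J(i)=1$, $J(-e^{-\pi i/\mu})=0$, $J(i\infty)=\infty$. Let $$E_2=\tfrac1b\bigl((b-a)y_1-b\,y_2+(a+b-1)y_3\bigr)$$ (the quasiautomorphic form of weight $2$ with $E_2(i\infty)=1$), $\delta=2\,\mathrm{lcm}(2,\mu)$, and $$\Delta=\Bigl(\tfrac{\theta J}{J(J-1)}\Bigr)^{\mu}J\,(J-1)^{\mu/2}\ (\mu\text{ even}),\qquad \Delta=\Bigl(\tfrac{\theta J}{J(J-1)}\Bigr)^{2\mu}J^2(J-1)^{\mu}\ (\mu\text{ odd}),$$ removable singularities being removed. Define $\partial_k f=\theta f-\frac{k(\mu-2)}{4\mu}E_2f$, $\partial_k^0f=f$, $\partial_k^{n+1}f=\partial_{k+2n}(\partial_k^nf)$. Let $w\in\mathbb Z$, $r\ge 0$, $B_{2j}\in\mathcal M_{2j}$ for $2\le j\le r+1$, and consider the equation of order $r+1$ $$\mathsf H_{\mathbf B}[y]:\qquad \partial_{w-r}^{r+1}y+B_4\,\partial_{w-r}^{r-1}y+\cdots+B_{2r+2}\,y=0 .$$ Suppose that the roots, with multiplicity,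 of its indicial polynomial at $q=0$ are integers $\lambda_0\ge\lambda_1\ge\cdots\ge\lambda_r\ge 0$. Let $Y_0,\dots,Y_r$ be a fundamental system of solutions of $\mathsf H_{\mathbf B}[y]$, holomorphic on $\mathbb H$, and let $\mathcal W=\det\bigl(\partial_{w-r}^{j}Y_i\bigr)_{0\le i,j\le r}$ be its Wronskian. Then $$\mathcal W=C\,\Delta^{\frac{w(r+1)}{\delta}}\quad\text{on }\mathbb H$$ for some complex constant $C\ne 0$. Here $\Delta$ has a holomorphic logarithm on $\mathbb H$, and, should the exponent not be an integer, the power is formed with any such logarithm (changing it only changes $C$). -/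

import Mathlib

open UpperHalfPlane hiding I
open Complex
open scoped MatrixGroups Manifold

noncomputable section

namespace Hecke

/-- The width `ϖ_μ = 2 cos (π / μ)`. -/
def width (μ : ℕ) : ℝ := 2 * Real.cos (Real.pi / μ)

/-- The matrix of `z ↦ -1 / z`. -/
def matS : SL(2, ℝ) := ⟨!![0, -1; 1, 0], by simp [Matrix.det_fin_two]⟩

/-- The matrix of `z ↦ z + ϖ_μ`. -/
def matT (μ : ℕ) : SL(2, ℝ) := ⟨!![1, width μ; 0, 1], by simp [Matrix.det_fin_two]⟩

/-- The Hecke triangle group of signature `(2, μ, ∞)`, generated by `z ↦ -1 / z` and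
`z ↦ z + ϖ_μ`. -/
def group (μ : ℕ) : Subgroup (GL (Fin 2) ℝ) :=
  (Subgroup.closure {matS, matT μ}).map Matrix.SpecialLinearGroup.toGL

/-- The space of Hecke automorphic forms of weight `k`: holomorphic on `ℍ`, invariant under the
weight `k` slash action of the Hecke group, bounded at the cusps. -/
abbrev AutomorphicForm (μ : ℕ) (k : ℤ) : Type := ModularForm (group μ) k

/-- The Boole operator `θ = q d/dq = (ϖ / 2πi) d/dz`, where `q = exp (2πi z / ϖ)`. -/
def theta (μ : ℕ) (f : ℂ → ℂ) (z : ℂ) : ℂ := (width μ : ℂ) / (2 * Real.pi * I) * deriv f z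

/-- The Boole operator on functions on the upper half plane. -/
def thetaH (μ : ℕ) (f : ℍ → ℂ) (z : ℍ) : ℂ := theta μ (f ∘ ofComplex) z

/-! ### The Darboux-Halphen system of signature `(2, μ, ∞)` -/

def constA (μ : ℕ) : ℂ := (1 - 1 / 2 + 1 / μ) / 2

def constB (μ : ℕ) : ℂ := (1 - 1 / 2 - 1 / μ) / 2

def constC (μ : ℕ) : ℂ := (1 + 1 / 2 - 1 / μ) / 2

/-- `y₁, y₂, y₃` are meromorphic on the upper half plane and solve the Darboux-Halphen system
there (as an identity of meromorphic functions, that is, off a discrete closed set). -/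
structure IsDarbouxHalphen (μ : ℕ) (y₁ y₂ y₃ : ℂ → ℂ) : Prop where
  mero₁ : MeromorphicOn y₁ upperHalfPlaneSet
  mero₂ : MeromorphicOn y₂ upperHalfPlaneSet
  mero₃ : MeromorphicOn y₃ upperHalfPlaneSet
  eqn₁ : ∀ᶠ z in Filter.codiscreteWithin upperHalfPlaneSet,
    theta μ y₁ z = (constA μ - 1) * (y₁ z * y₂ z + y₁ z * y₃ z - y₂ z * y₃ z)
      + (constB μ + constC μ - 1) * y₁ z ^ 2
  eqn₂ : ∀ᶠ z in Filter.codiscreteWithin upperHalfPlaneSet,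
    theta μ y₂ z = (constB μ - 1) * (y₂ z * y₁ z + y₂ z * y₃ z - y₁ z * y₃ z)
      + (constA μ + constC μ - 1) * y₂ z ^ 2
  eqn₃ : ∀ᶠ z in Filter.codiscreteWithin upperHalfPlaneSet,
    theta μ y₃ z = (constC μ - 1) * (y₃ z * y₁ z + y₃ z * y₂ z - y₁ z * y₂ z)
      + (constA μ + constB μ - 1) * y₃ z ^ 2

/-- `J = (y₃ - y₂) / (y₃ - y₁)`, as a meromorphic function on the upper half plane: the normal
form takes at a removable singularity the value of the continuous extension. -/
def hauptmodul (y₁ y₂ y₃ : ℂ → ℂ) : ℂ → ℂ :=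
  toMeromorphicNFOn (fun z => (y₃ z - y₂ z) / (y₃ z - y₁ z)) upperHalfPlaneSet

/-- The Darboux-Halphen functions of the Hecke group. The Darboux-Halphen system determines its
solution only up to Möbius substitutions in `z`; the solution meant is the one whose quotient `J`
is the hauptmodul of the Hecke group with `J (i) = 1`, `J (-exp (-πi / μ)) = 0`, `J (i∞) = ∞`. -/
structure IsHeckeHalphen (μ : ℕ) (y₁ y₂ y₃ : ℂ → ℂ) : Prop
    extends IsDarbouxHalphen μ y₁ y₂ y₃ where
  automorphic : ∀ γ ∈ group μ, ∀ z : ℍ,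
    hauptmodul y₁ y₂ y₃ ((γ • z : ℍ) : ℂ) = hauptmodul y₁ y₂ y₃ (z : ℂ)
  at_r₁ : hauptmodul y₁ y₂ y₃ I = 1
  at_r₂ : hauptmodul y₁ y₂ y₃ (-exp (-(Real.pi * I) / μ)) = 0
  at_infty : Filter.Tendsto (fun z : ℍ => ‖hauptmodul y₁ y₂ y₃ (z : ℂ)‖) atImInfty Filter.atTop

/-- The quasiautomorphic form `E₂` of weight `2`, normalized by `E₂ (i∞) = 1`. -/
def E2 (μ : ℕ) (y₁ y₂ y₃ : ℂ → ℂ) (z : ℍ) : ℂ :=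
  toMeromorphicNFOn
    (fun x => 1 / constB μ * ((constB μ - constA μ) * y₁ x - constB μ * y₂ x
      + (constB μ + constA μ - 1) * y₃ x))
    upperHalfPlaneSet z

/-- The discriminant built from the hauptmodul `J`, singularities being removed. -/
def discriminant (μ : ℕ) (J : ℂ → ℂ) (z : ℍ) : ℂ :=
  toMeromorphicNFOn
    (fun x =>
      if Even μ then (theta μ J x / (J x * (J x - 1))) ^ μ * J x * (J x - 1) ^ (μ / 2)
      else (theta μ J x / (J x * (J x - 1))) ^ (2 * μ) * J x ^ 2 * (J x - 1) ^ μ)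
    upperHalfPlaneSet z

/-- The weight `δ = 2 lcm (2, μ)` of the discriminant. -/
def delta (μ : ℕ) : ℕ := 2 * Nat.lcm 2 μ

/-! ### Ramanujan-Serre derivatives, the differential equation and the Wronskian

In this part `E` stands for the function `E₂` of the Hecke group. -/

/-- `∂_k f = θ f - (k (μ - 2) / (4 μ)) E₂ f`. -/
def serre (μ : ℕ) (E : ℍ → ℂ) (k : ℤ) (f : ℍ → ℂ) (z : ℍ) : ℂ :=
  thetaH μ f z - (k : ℂ) * ((μ : ℂ) - 2) / (4 * μ) * E z * f z

/-- `∂_k^0 f = f` and `∂_k^(n+1) f = ∂_(k+2n) (∂_k^n f)`. -/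
def serreIter (μ : ℕ) (E : ℍ → ℂ) (k : ℤ) : ℕ → (ℍ → ℂ) → ℍ → ℂ
  | 0, f => f
  | n + 1, f => serre μ E (k + 2 * n) (serreIter μ E k n f)

/-- The left-hand side of the equation
`∂_(w-r)^(r+1) y + B₄ ∂_(w-r)^(r-1) y + ⋯ + B_(2r+2) y = 0`; here `B j` has weight `2 j`, and only
the `B j` with `2 ≤ j ≤ r + 1` occur. -/
def odeLHS (μ : ℕ) (E : ℍ → ℂ) (w : ℤ) (r : ℕ) (B : ∀ j : ℕ, AutomorphicForm μ (2 * j))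
    (y : ℍ → ℂ) (z : ℍ) : ℂ :=
  serreIter μ E (w - r) (r + 1) y z
    + ∑ j ∈ Finset.Icc 2 (r + 1), B j z * serreIter μ E (w - r) (r + 1 - j) y z

/-- The indicial polynomial at `q = 0` of `∂_k^n`: each `θ` becomes `X`, each coefficient its value
at `i∞`. -/
def indicialSerre (μ : ℕ) (E : ℍ → ℂ) (k : ℤ) (n : ℕ) : Polynomial ℂ :=
  ∏ m ∈ Finset.range n,
    (Polynomial.X - Polynomial.C
      (((k + 2 * m : ℤ) : ℂ) * ((μ : ℂ) - 2) / (4 * μ) * valueAtInfty E))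

/-- The indicial polynomial at `q = 0` of the differential equation. -/
def indicial (μ : ℕ) (E : ℍ → ℂ) (w : ℤ) (r : ℕ) (B : ∀ j : ℕ, AutomorphicForm μ (2 * j)) :
    Polynomial ℂ :=
  indicialSerre μ E (w - r) (r + 1)
    + ∑ j ∈ Finset.Icc 2 (r + 1),
        Polynomial.C (valueAtInfty (B j)) * indicialSerre μ E (w - r) (r + 1 - j)

/-- `Y 0, …, Y r` is a fundamental system of solutions, holomorphic on the upper half plane, of
the differential equation, which has order `r + 1`. -/
structure IsFundamentalSolution (μ : ℕ) (E : ℍ → ℂ) (w : ℤ) (r : ℕ)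
    (B : ∀ j : ℕ, AutomorphicForm μ (2 * j)) (Y : Fin (r + 1) → ℍ → ℂ) : Prop where
  holo : ∀ i, MDiff (Y i)
  solves : ∀ i z, odeLHS μ E w r B (Y i) z = 0
  indep : LinearIndependent ℂ Y

/-- The Wronskian `det (∂_(w-r)^j Y_i)`. -/
def wronskian (μ : ℕ) (E : ℍ → ℂ) (w : ℤ) (r : ℕ) (Y : Fin (r + 1) → ℍ → ℂ) (z : ℍ) : ℂ :=
  (Matrix.of fun i j : Fin (r + 1) => serreIter μ E (w - r) j (Y i) z).det

/-- `L` is a holomorphic branch of `log f` on the upper half plane. The powers `f ^ p` with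
`p` rational are then the functions `exp (p L)`. -/
def IsLogBranch (L f : ℍ → ℂ) : Prop := MDiff L ∧ ∀ z, exp (L z) = f z

end Hecke

end

/-!
By the Darboux-Halphen system `θ log J = y₂ - y₁`, `θ log (J - 1) = y₂ - y₃`, and hence
`θ log Δ = δ b E₂`; moreover `u = b E₂` satisfies the Riccati equation
`θ u = u² - b² θ log J θ log (J - 1)`. At a point of `ℍ` where `Δ` has order `M`, the coefficients
of the double poles give a quadratic equation for `M / δ` in terms of the orders of `J` and `J - 1`,
whose only admissible root is `0`. Thus `Δ` is holomorphic without zeros and `E₂` is holomorphic on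
all of `ℍ`.

As the term `∂ʳ y` is missing from the equation, the first order system for `(y, ∂ y, …, ∂ʳ y)` has
trace `∑ j ≤ r, (w - r + 2 j) b E₂ = w (r + 1) b E₂`, so by Liouville's formula the Wronskian `W`
satisfies `θ W = (w (r + 1) / δ) (θ log Δ) W`. A zero of `W` would produce a nontrivial solution of
the first order system with a zero, that is, a linear relation between the `Yᵢ`.
-/

noncomputable section

namespace Hecke

open Filter Topology

section Residues

variable {𝕜 : Type*} [NontriviallyNormedField 𝕜] {f g h : 𝕜 → 𝕜} {x : 𝕜}
  {l m n : ℤ}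

lemma logDeriv_pow_mul_pow_mul_pow {k₁ k₂ k₃ : ℕ} (hf : DifferentiableAt 𝕜 f x)
    (hg : DifferentiableAt 𝕜 g x) (hh : DifferentiableAt 𝕜 h x) (hf0 : f x ≠ 0) (hg0 : g x ≠ 0)
    (hh0 : h x ≠ 0) :
    logDeriv (fun z => f z ^ k₁ * g z ^ k₂ * h z ^ k₃) x =
      k₁ * logDeriv f x + k₂ * logDeriv g x + k₃ * logDeriv h x := by
  rw [logDeriv_mul (f := fun z => f z ^ k₁ * g z ^ k₂) (g := fun z => h z ^ k₃) x
      (mul_ne_zero (pow_ne_zero _ hf0) (pow_ne_zero _ hg0)) (pow_ne_zero _ hh0)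
      ((hf.fun_pow _).fun_mul (hg.fun_pow _)) (hh.fun_pow _),
    logDeriv_mul (f := fun z => f z ^ k₁) (g := fun z => g z ^ k₂) x (pow_ne_zero _ hf0)
      (pow_ne_zero _ hg0) (hf.fun_pow _) (hg.fun_pow _),
    logDeriv_fun_pow hf, logDeriv_fun_pow hg, logDeriv_fun_pow hh]

lemma meromorphicOrderAt_pow_mul_pow_mul_pow {k₁ k₂ k₃ : ℕ} (hf : MeromorphicAt f x)
    (hg : MeromorphicAt g x) (hh : MeromorphicAt h x) (hl : meromorphicOrderAt f x = l)
    (hm : meromorphicOrderAt g x = m) (hn : meromorphicOrderAt h x = n) :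
    meromorphicOrderAt (fun z => f z ^ k₁ * g z ^ k₂ * h z ^ k₃) x =
      ((k₁ * l + k₂ * m + k₃ * n : ℤ) : WithTop ℤ) := by
  rw [fun_meromorphicOrderAt_mul ((hf.fun_pow k₁).fun_mul (hg.fun_pow k₂)) (hh.fun_pow k₃),
    fun_meromorphicOrderAt_mul (hf.fun_pow k₁) (hg.fun_pow k₂), fun_meromorphicOrderAt_pow hf,
    fun_meromorphicOrderAt_pow hg, fun_meromorphicOrderAt_pow hh, hl, hm, hn]
  norm_cast

variable [CompleteSpace 𝕜]

lemma exists_logDeriv_eventuallyEq_div_add (hf : MeromorphicAt f x)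
    (hn : meromorphicOrderAt f x = n) :
    ∃ g : 𝕜 → 𝕜, AnalyticAt 𝕜 g x ∧ logDeriv f =ᶠ[𝓝[≠] x] fun z => n / (z - x) + g z := by
  obtain ⟨g, hg, hgx, hfg⟩ := (meromorphicOrderAt_eq_int_iff hf).1 hn
  refine ⟨logDeriv g, hg.deriv.div hg hgx, (logDeriv_congr_nhdsNE hfg).trans ?_⟩
  filter_upwards [self_mem_nhdsWithin, hg.eventually_analyticAt.filter_mono nhdsWithin_le_nhds,
    (hg.continuousAt.eventually_ne hgx).filter_mono nhdsWithin_le_nhds] with z hz hgz hgz0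
  have hzx : z - x ≠ 0 := sub_ne_zero.2 hz
  have hd : DifferentiableAt 𝕜 (fun z => (z - x) ^ n) z :=
    (differentiableAt_id.sub_const x).zpow (Or.inl hzx)
  simp only [smul_eq_mul]
  rw [logDeriv_mul (f := fun z => (z - x) ^ n) z (zpow_ne_zero _ hzx) hgz0 hd hgz.differentiableAt,
    logDeriv_fun_zpow (by fun_prop)]
  simp [logDeriv_apply, div_eq_mul_inv]

lemma tendsto_sub_mul_logDeriv (hf : MeromorphicAt f x) (hn : meromorphicOrderAt f x = n) :
    Tendsto (fun z => (z - x) * logDeriv f z) (𝓝[≠] x) (𝓝 n) := by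
  obtain ⟨g, hg, hfg⟩ := exists_logDeriv_eventuallyEq_div_add hf hn
  have hc : ContinuousAt (fun z => (n : 𝕜) + (z - x) * g z) x := by
    have := hg.continuousAt
    fun_prop
  have ht : Tendsto (fun z => (n : 𝕜) + (z - x) * g z) (𝓝[≠] x) (𝓝 n) := by
    simpa using hc.tendsto.mono_left nhdsWithin_le_nhds
  refine ht.congr' ?_
  filter_upwards [hfg, self_mem_nhdsWithin] with z hz hzx
  have : z - x ≠ 0 := sub_ne_zero.2 hzx
  rw [hz]
  field_simp

lemma tendsto_sub_sq_mul_deriv_logDeriv (hf : MeromorphicAt f x)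
    (hn : meromorphicOrderAt f x = n) :
    Tendsto (fun z => (z - x) ^ 2 * deriv (logDeriv f) z) (𝓝[≠] x) (𝓝 (-n)) := by
  obtain ⟨g, hg, hfg⟩ := exists_logDeriv_eventuallyEq_div_add hf hn
  have hc : ContinuousAt (fun z => -(n : 𝕜) + (z - x) ^ 2 * deriv g z) x := by
    have := hg.deriv.continuousAt
    fun_prop
  have ht : Tendsto (fun z => -(n : 𝕜) + (z - x) ^ 2 * deriv g z) (𝓝[≠] x) (𝓝 (-n)) := by
    simpa using hc.tendsto.mono_left nhdsWithin_le_nhds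
  refine ht.congr' ?_
  filter_upwards [hfg.nhdsNE_deriv, self_mem_nhdsWithin,
    hg.eventually_analyticAt.filter_mono nhdsWithin_le_nhds] with z hz hzx hgz
  have h0 : z - x ≠ 0 := sub_ne_zero.2 hzx
  have hd : HasDerivAt (fun z => (n : 𝕜) / (z - x) + g z)
      ((0 * (z - x) - n * 1) / (z - x) ^ 2 + deriv g z) z :=
    ((hasDerivAt_const z (n : 𝕜)).div ((hasDerivAt_id z).sub_const x) h0).add
      hgz.differentiableAt.hasDerivAt
  rw [hz, hd.deriv]
  field_simp
  ring

/- Compare the coefficients of `(z - x)⁻²`. -/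
lemma neg_order_eq_of_riccati {c d : 𝕜} (hf : MeromorphicAt f x) (hg : MeromorphicAt g x)
    (hh : MeromorphicAt h x) (hl : meromorphicOrderAt f x = l) (hm : meromorphicOrderAt g x = m)
    (hn : meromorphicOrderAt h x = n)
    (hric : ∀ᶠ z in 𝓝[≠] x,
      deriv (logDeriv f) z = c * logDeriv f z ^ 2 - d * (logDeriv g z * logDeriv h z)) :
    -(l : 𝕜) = c * l ^ 2 - d * (m * n) := by
  have hright := (((tendsto_sub_mul_logDeriv hf hl).pow 2).const_mul c).sub
    (((tendsto_sub_mul_logDeriv hg hm).mul (tendsto_sub_mul_logDeriv hh hn)).const_mul d)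
  refine tendsto_nhds_unique (tendsto_sub_sq_mul_deriv_logDeriv hf hl) (hright.congr' ?_)
  filter_upwards [hric] with z hz
  rw [hz]
  ring

lemma neg_one_le_meromorphicOrderAt_logDeriv [CharZero 𝕜] (hf : MeromorphicAt f x)
    (hf' : meromorphicOrderAt f x ≠ ⊤) : -1 ≤ meromorphicOrderAt (logDeriv f) x := by
  by_cases h0 : meromorphicOrderAt f x = 0
  · exact le_trans (by decide) (meromorphicOrderAt_logDeriv_nonneg hf h0)
  · exact (meromorphicOrderAt_logDeriv_eq_neg_one hf h0 hf').ge

end Residues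

lemma indicialRoot_eq_zero {m : ℝ} (hm : 0 < m) {a p s : ℤ} (has : -1 ≤ a + s) (hap : -1 ≤ a + p)
    (hp : p ≠ 0 → a + s = -1) (hs : s ≠ 0 → a + p = -1)
    (h : (a / 2 + p / (2 * m) + s / 4 : ℝ) ^ 2 + (a / 2 + p / (2 * m) + s / 4) =
      ((m - 2) / (4 * m)) ^ 2 * (p * s)) :
    (a / 2 + p / (2 * m) + s / 4 : ℝ) = 0 := by
  by_cases hps : p ≠ 0 ∧ s ≠ 0
  · obtain rfl : s = p := by linarith [hp hps.1, hs hps.2]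
    obtain rfl : a = -1 - s := by linarith [hp hps.1]
    push_cast at h
    field_simp at h
    nlinarith
  · have hps0 : (p * s : ℝ) = 0 := by
      exact_mod_cast mul_eq_zero.2 (by tauto)
    have hlower : -1 / 2 ≤ (a / 2 + p / (2 * m) + s / 4 : ℝ) := by
      have hnonneg : -1 ≤ a ∧ 0 ≤ p ∧ 0 ≤ s := by grind
      have : (-1 : ℝ) ≤ a := by exact_mod_cast hnonneg.1
      have hp' : (0 : ℝ) ≤ p := by exact_mod_cast hnonneg.2.1
      have : (0 : ℝ) ≤ s := by exact_mod_cast hnonneg.2.2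
      have : 0 ≤ p / (2 * m) := by positivity
      linarith
    rw [hps0, mul_zero] at h
    nlinarith

section LinearSystem

open Matrix

variable {n : Type*} [Fintype n]

lemma hasDerivAt_det [DecidableEq n] {𝕜 : Type*} [NontriviallyNormedField 𝕜]
    {M : 𝕜 → Matrix n n 𝕜} {M' : Matrix n n 𝕜} {x : 𝕜}
    (hM : ∀ i j, HasDerivAt (fun z => M z i j) (M' i j) x) :
    HasDerivAt (fun z => (M z).det) (∑ i, ((M x).updateRow i (M' i)).det) x := by
  let detCLM : ContinuousMultilinearMap 𝕜 (fun _ : n => n → 𝕜) 𝕜 :=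
    { (detRowAlternating (n := n) (R := 𝕜)).toMultilinearMap with
      cont := Continuous.matrix_det (A := fun M : Matrix n n 𝕜 => M) continuous_id }
  have hrow (i : n) : HasFDerivAt (fun z => M z i) ((1 : 𝕜 →L[𝕜] 𝕜).smulRight (M' i)) x :=
    (hasDerivAt_pi.2 fun j => hM i j).hasFDerivAt
  have hdet : HasDerivAt (fun z => (M z).det) _ x :=
    (HasFDerivAt.multilinear_comp (f := detCLM) hrow).hasDerivAt
  convert hdet using 1
  rw [_root_.sum_apply]
  exact Finset.sum_congr rfl fun i _ => by
    rw [ContinuousLinearMap.comp_apply, ContinuousLinearMap.smulRight_apply,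
      one_apply_eq_self, one_smul]
    rfl

lemma hasDerivAt_det_of_linearSystem [DecidableEq n] {𝕜 : Type*} [NontriviallyNormedField 𝕜]
    {M : 𝕜 → Matrix n n 𝕜} {A : Matrix n n 𝕜} {x : 𝕜}
    (hM : ∀ i j, HasDerivAt (fun z => M z i j) ((A * M x) i j) x) :
    HasDerivAt (fun z => (M z).det) (A.trace * (M x).det) x := by
  convert hasDerivAt_det hM using 1
  rw [trace, Finset.sum_mul]
  refine Finset.sum_congr rfl fun i _ => ?_
  rw [diag_apply, ← smul_eq_mul, ← det_updateRow_sum]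
  congr 2
  ext j
  simp [mul_apply]

/- A zero of finite order `k` is impossible: `deriv u` has order `k - 1`, while `A u` has order at
least `k`. -/
lemma analyticOrderAt_eq_top_of_linearSystem {𝕜 : Type*} [NontriviallyNormedField 𝕜]
    [CompleteSpace 𝕜] [CharZero 𝕜] {A : 𝕜 → Matrix n n 𝕜} {u : 𝕜 → n → 𝕜} {x : 𝕜}
    (hA : ∀ i j, AnalyticAt 𝕜 (fun z => A z i j) x) (hu : AnalyticAt 𝕜 u x)
    (hsys : ∀ᶠ z in 𝓝 x, deriv u z = A z *ᵥ u z) (hux : u x = 0) :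
    analyticOrderAt u x = ⊤ := by
  by_contra htop
  obtain ⟨k, hk⟩ := ENat.ne_top_iff_exists.1 htop
  obtain ⟨g, hg, hug⟩ := (natCast_le_analyticOrderAt hu).1 hk.le
  have hAg : AnalyticAt 𝕜 (fun z => A z *ᵥ g z) x := analyticAt_pi_iff.2 fun i =>
    Finset.analyticAt_fun_sum _ fun j _ => (hA i j).mul (analyticAt_pi_iff.1 hg j)
  have hle : (k : ℕ∞) ≤ analyticOrderAt (deriv u) x := by
    refine (natCast_le_analyticOrderAt hu.deriv).2 ⟨_, hAg, ?_⟩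
    filter_upwards [hsys, hug] with z hz hgz
    rw [hz, hgz, mulVec_smul]
  have hderiv := hu.analyticOrderAt_deriv_add_one
  simp only [hux, sub_zero] at hderiv
  have hlt : (k : ℕ∞) + 1 ≤ k := by
    calc (k : ℕ∞) + 1 ≤ analyticOrderAt (deriv u) x + 1 := by gcongr
      _ = k := by rw [hderiv, hk]
  exact absurd hlt (by exact_mod_cast Nat.not_succ_le_self k)

lemma exists_mulVec_eq_zero_of_det_eq_zero [DecidableEq n] {M A : ℂ → Matrix n n ℂ} {U : Set ℂ}
    {x : ℂ} (hU : IsOpen U) (hU' : IsPreconnected U) (hx : x ∈ U)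
    (hA : ∀ i j, ∀ z ∈ U, AnalyticAt ℂ (fun z => A z i j) z)
    (hM : ∀ i j, ∀ z ∈ U, HasDerivAt (fun z => M z i j) ((A z * M z) i j) z)
    (hdet : (M x).det = 0) : ∃ c ≠ 0, ∀ z ∈ U, M z *ᵥ c = 0 := by
  obtain ⟨c, hc, hMc⟩ := exists_mulVec_eq_zero_iff.2 hdet
  have hderiv (z : ℂ) (hz : z ∈ U) : HasDerivAt (fun z => M z *ᵥ c) (A z *ᵥ (M z *ᵥ c)) z := by
    rw [mulVec_mulVec]
    exact hasDerivAt_pi.2 fun i => HasDerivAt.fun_sum fun j _ => (hM i j z hz).mul_const (c j)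
  have han : AnalyticOnNhd ℂ (fun z => M z *ᵥ c) U :=
    DifferentiableOn.analyticOnNhd
      (fun z hz => (hderiv z hz).differentiableAt.differentiableWithinAt) hU
  have htop := analyticOrderAt_eq_top_of_linearSystem (fun i j => hA i j x hx) (han x hx)
    (mem_of_superset (hU.mem_nhds hx) fun z hz => (hderiv z hz).deriv) hMc
  exact ⟨c, hc, han.eqOn_zero_of_preconnected_of_eventuallyEq_zero hU' hx
    (analyticOrderAt_eq_top.1 htop)⟩

end LinearSystem

section NormalForm

variable {𝕜 E : Type*} [NontriviallyNormedField 𝕜] [NormedAddCommGroup E] [NormedSpace 𝕜 E]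
  {f g : 𝕜 → E} {U : Set 𝕜} {x : 𝕜}

lemma meromorphicOrderAt_sub_const_ne_top (hf : MeromorphicNFOn f U) (hU : IsPreconnected U)
    (hne : (f '' U).Nontrivial) (hx : x ∈ U) (c : E) :
    meromorphicOrderAt (fun z => f z - c) x ≠ ⊤ := by
  obtain ⟨_, ⟨z, hz, rfl⟩, hzc⟩ := hne.exists_ne c
  have hm : MeromorphicOn (fun z => f z - c) U := fun u hu =>
    (hf hu).meromorphicAt.sub (MeromorphicAt.const c u)
  refine hm.meromorphicOrderAt_ne_top_of_isPreconnected hU hz hx fun htop => hzc ?_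
  have hconst : f =ᶠ[𝓝[≠] z] fun _ => c := by
    filter_upwards [meromorphicOrderAt_eq_top_iff.1 htop] with u hu using sub_eq_zero.1 hu
  exact (((hf hz).eventuallyEq_nhdsNE_iff_eventuallyEq_nhds
    analyticAt_const.meromorphicNFAt).1 hconst).eq_of_nhds

lemma toMeromorphicNFOn_apply_eq (hf : MeromorphicOn f U) (hx : x ∈ U) (hg : AnalyticAt 𝕜 g x)
    (hfg : f =ᶠ[𝓝[≠] x] g) : toMeromorphicNFOn f U x = g x :=
  (((meromorphicNFOn_toMeromorphicNFOn f U hx).eventuallyEq_nhdsNE_iff_eventuallyEq_nhds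
    hg.meromorphicNFAt).1
      ((hf.toMeromorphicNFOn_eq_self_on_nhdsNE hx).trans hfg)).eq_of_nhds

end NormalForm

lemma width_pos {μ : ℕ} (hμ : 3 ≤ μ) : 0 < width μ := by
  have h3 : (3 : ℝ) ≤ μ := by exact_mod_cast hμ
  refine mul_pos two_pos (Real.cos_pos_of_mem_Ioo ⟨?_, ?_⟩)
  · have : 0 ≤ Real.pi / μ := by positivity
    linarith [Real.pi_pos]
  · exact div_lt_div_of_pos_left Real.pi_pos two_pos (by linarith)

/-- The factor `ϖ / 2πi` of the Boole operator. -/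
def thetaFactor (μ : ℕ) : ℂ := (width μ : ℂ) / (2 * Real.pi * I)

lemma theta_eq (μ : ℕ) (f : ℂ → ℂ) (z : ℂ) : theta μ f z = thetaFactor μ * deriv f z := rfl

lemma thetaH_eq (μ : ℕ) (f : ℍ → ℂ) (z : ℍ) :
    thetaH μ f z = thetaFactor μ * deriv (f ∘ ofComplex) z := rfl

lemma thetaFactor_ne_zero {μ : ℕ} (hμ : 3 ≤ μ) : thetaFactor μ ≠ 0 := by
  simp [thetaFactor, (width_pos hμ).ne', Real.pi_ne_zero]

lemma constB_eq {μ : ℕ} (hμ : μ ≠ 0) : constB μ = ((μ : ℂ) - 2) / (4 * μ) := by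
  have : (μ : ℂ) ≠ 0 := by exact_mod_cast hμ
  unfold constB
  field_simp
  ring

lemma constB_ne_zero {μ : ℕ} (hμ : 3 ≤ μ) : constB μ ≠ 0 := by
  have h0 : (μ : ℂ) ≠ 0 := by exact_mod_cast (by omega : μ ≠ 0)
  have h2 : (μ : ℂ) - 2 ≠ 0 := by
    rw [sub_ne_zero]
    exact_mod_cast (by omega : μ ≠ 2)
  rw [constB_eq (by omega)]
  exact div_ne_zero h2 (mul_ne_zero (by norm_num) h0)

lemma eventually_nhdsNE_of_eventually_codiscreteWithin {X : Type*} [TopologicalSpace X]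
    {P : X → Prop} {U : Set X} {x : X} (h : ∀ᶠ z in codiscreteWithin U, P z) (hU : U ∈ 𝓝 x) :
    ∀ᶠ z in 𝓝[≠] x, P z := by
  filter_upwards [mem_codiscreteWithin_iff_forall_mem_nhdsNE.1 h x (mem_of_mem_nhds hU),
    nhdsWithin_le_nhds hU] with z hz hzU
  exact hz.resolve_right (not_not_intro hzU)

lemma isPreconnected_upperHalfPlaneSet : IsPreconnected upperHalfPlaneSet :=
  (convex_halfSpace_im_gt 0).isPreconnected

lemma upperHalfPlaneSet_mem_nhds (z : ℍ) : upperHalfPlaneSet ∈ 𝓝 (z : ℂ) :=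
  isOpen_upperHalfPlaneSet.mem_nhds z.2

section UpperHalfPlane

variable {f L : ℍ → ℂ}

lemma mdiff_of_differentiableAt {F : ℂ → ℂ}
    (hF : ∀ z ∈ upperHalfPlaneSet, DifferentiableAt ℂ F z) (hf : ∀ z : ℍ, f z = F z) : MDiff f := by
  rw [UpperHalfPlane.mdifferentiable_iff]
  refine DifferentiableOn.congr (fun z hz => (hF z hz).differentiableWithinAt) fun z hz => ?_
  rw [Function.comp_apply, hf, ofComplex_apply_of_im_pos hz]

lemma analyticAt_comp_ofComplex (hf : MDiff f) (z : ℍ) : AnalyticAt ℂ (f ∘ ofComplex) z :=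
  (UpperHalfPlane.mdifferentiable_iff.1 hf).analyticAt (upperHalfPlaneSet_mem_nhds z)

lemma mdiff_thetaH (μ : ℕ) (hf : MDiff f) : MDiff (thetaH μ f) := by
  refine mdiff_of_differentiableAt (F := fun z => thetaFactor μ * deriv (f ∘ ofComplex) z)
    (fun z hz => ?_) (thetaH_eq μ f)
  exact (analyticAt_comp_ofComplex hf ⟨z, hz⟩).deriv.differentiableAt.const_mul _

lemma isSimplyConnected_upperHalfPlaneSet : IsSimplyConnected upperHalfPlaneSet := by
  have : ContractibleSpace upperHalfPlaneSet :=
    (convex_halfSpace_im_gt 0).contractibleSpace ⟨UpperHalfPlane.I, UpperHalfPlane.I.2⟩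
  exact inferInstanceAs (SimplyConnectedSpace upperHalfPlaneSet)

/- Near `x` the function `f` is `f x + log (g / g x)` for the principal branch of the logarithm. -/
lemma differentiableAt_of_exp_eq {f g : ℂ → ℂ} {x : ℂ} (hf : ContinuousAt f x)
    (hg : DifferentiableAt ℂ g x) (h : ∀ᶠ z in 𝓝 x, exp (f z) = g z) :
    DifferentiableAt ℂ f x := by
  have hx : exp (f x) = g x := h.self_of_nhds
  have him : ∀ᶠ z in 𝓝 x, (f z - f x).im ∈ Set.Ioo (-Real.pi) Real.pi :=
    (continuous_im.continuousAt.comp (hf.sub continuousAt_const)).eventually_mem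
      (Ioo_mem_nhds (by simp [Real.pi_pos]) (by simp [Real.pi_pos]))
  have hlog : f =ᶠ[𝓝 x] fun z => f x + log (g z / g x) := by
    filter_upwards [him, h] with z hz hgz
    rw [← hgz, ← hx, ← exp_sub, log_exp hz.1 hz.2.le, add_sub_cancel]
  refine DifferentiableAt.congr_of_eventuallyEq ?_ hlog
  refine ((hg.div_const _).clog ?_).const_add _
  rw [div_self (hx ▸ exp_ne_zero _)]
  exact one_mem_slitPlane

lemma exists_isLogBranch (hf : MDiff f) (hf0 : ∀ z, f z ≠ 0) : ∃ L : ℍ → ℂ, IsLogBranch L f := by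
  have hF := UpperHalfPlane.mdifferentiable_iff.1 hf
  obtain ⟨L, hLc, hL⟩ := exists_continuousOn_eqOn_exp_comp isSimplyConnected_upperHalfPlaneSet
    isOpen_upperHalfPlaneSet hF.continuousOn (by rintro ⟨z, -, h⟩; exact hf0 _ h)
  refine ⟨fun z => L z, mdiff_of_differentiableAt (fun z hz => ?_) fun _ => rfl, fun z => ?_⟩
  · have hU := isOpen_upperHalfPlaneSet.mem_nhds hz
    exact differentiableAt_of_exp_eq (hLc.continuousAt hU) (hF.differentiableAt hU)
      (mem_of_superset hU fun u hu => hL hu)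
  · simpa using hL z.2

lemma IsLogBranch.logDeriv_comp_ofComplex (hL : IsLogBranch L f) (z : ℍ) :
    logDeriv (f ∘ ofComplex) z = deriv (L ∘ ofComplex) z := by
  have hf : f ∘ ofComplex = fun u => exp ((L ∘ ofComplex) u) := funext fun u => (hL.2 _).symm
  rw [hf, logDeriv_apply, deriv_cexp (analyticAt_comp_ofComplex hL.1 z).differentiableAt,
    mul_div_cancel_left₀ _ (exp_ne_zero _)]

lemma exists_eq_const_mul_exp {μ : ℕ} (hμ : 3 ≤ μ) (hf : MDiff f) (hf0 : ∀ z, f z ≠ 0)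
    (hL : MDiff L) {p : ℂ} (h : ∀ z, thetaH μ f z = p * thetaH μ L z * f z) :
    ∃ C : ℂ, C ≠ 0 ∧ ∀ z, f z = C * exp (p * L z) := by
  have hL' := fun z : ℍ => (analyticAt_comp_ofComplex hL z).differentiableAt
  have hlog : Set.EqOn (logDeriv (f ∘ ofComplex))
      (logDeriv fun z => exp (p * (L ∘ ofComplex) z)) upperHalfPlaneSet := fun z hz => by
    lift z to ℍ using hz
    have hz : deriv (f ∘ ofComplex) z = p * deriv (L ∘ ofComplex) z * f z := by
      refine mul_left_cancel₀ (thetaFactor_ne_zero hμ) ?_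
      rw [← thetaH_eq, h, thetaH_eq]
      ring
    rw [logDeriv_apply, logDeriv_apply, deriv_cexp ((hL' z).const_mul p), hz,
      deriv_const_mul_field', mul_div_cancel_left₀ _ (exp_ne_zero _), Function.comp_apply,
      ofComplex_apply, mul_div_cancel_right₀ _ (hf0 z)]
  obtain ⟨C, hC, hfC⟩ := (logDeriv_eqOn_iff (UpperHalfPlane.mdifferentiable_iff.1 hf)
    (fun z hz => ((hL' ⟨z, hz⟩).const_mul p).cexp.differentiableWithinAt) isOpen_upperHalfPlaneSet
    isPreconnected_upperHalfPlaneSet (fun _ _ => exp_ne_zero _) fun _ _ => hf0 _).1 hlog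
  exact ⟨C, hC, fun z => by simpa using hfC z.2⟩

end UpperHalfPlane

section DarbouxHalphen

variable {μ : ℕ} {y₁ y₂ y₃ : ℂ → ℂ}

/-- A point at which the Darboux-Halphen system holds and `y₁, y₂, y₃` are differentiable with
pairwise distinct values, so that `J` is differentiable there and different from `0`, `1`, `∞`. -/
structure IsRegularPoint (μ : ℕ) (y₁ y₂ y₃ : ℂ → ℂ) (z : ℂ) : Prop where
  diff₁ : DifferentiableAt ℂ y₁ z
  diff₂ : DifferentiableAt ℂ y₂ z
  diff₃ : DifferentiableAt ℂ y₃ z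
  eqn₁ : theta μ y₁ z = (constA μ - 1) * (y₁ z * y₂ z + y₁ z * y₃ z - y₂ z * y₃ z)
      + (constB μ + constC μ - 1) * y₁ z ^ 2
  eqn₂ : theta μ y₂ z = (constB μ - 1) * (y₂ z * y₁ z + y₂ z * y₃ z - y₁ z * y₃ z)
      + (constA μ + constC μ - 1) * y₂ z ^ 2
  eqn₃ : theta μ y₃ z = (constC μ - 1) * (y₃ z * y₁ z + y₃ z * y₂ z - y₁ z * y₂ z)
      + (constA μ + constB μ - 1) * y₃ z ^ 2
  ne₁₂ : y₁ z - y₂ z ≠ 0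
  ne₃₁ : y₃ z - y₁ z ≠ 0
  ne₃₂ : y₃ z - y₂ z ≠ 0

/-- The form `θ J / (J (J - 1))` of weight `2` from which the discriminant is built. -/
def weightTwo (μ : ℕ) (J : ℂ → ℂ) (z : ℂ) : ℂ := theta μ J z / (J z * (J z - 1))

/-- The product `b E₂`, which satisfies a Riccati equation and is the logarithmic derivative of the
discriminant divided by `δ`. -/
def scaledE2 (μ : ℕ) (y₁ y₂ y₃ : ℂ → ℂ) (z : ℂ) : ℂ :=
  (constB μ - constA μ) * y₁ z - constB μ * y₂ z + (constB μ + constA μ - 1) * y₃ z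

namespace IsRegularPoint

variable {z : ℂ}

lemma logDeriv_sub₃₁ (h : IsRegularPoint μ y₁ y₂ y₃ z) :
    thetaFactor μ * logDeriv (fun x => y₃ x - y₁ x) z = (constB μ + constC μ - 1) * y₁ z
      + (constA μ + constC μ - 2) * y₂ z + (constA μ + constB μ - 1) * y₃ z := by
  have h₁ := h.eqn₁
  have h₃ := h.eqn₃
  rw [theta_eq] at h₁ h₃
  rw [logDeriv_apply, deriv_fun_sub h.diff₃ h.diff₁, mul_div, div_eq_iff h.ne₃₁]
  linear_combination h₃ - h₁

lemma logDeriv_sub₃₂ (h : IsRegularPoint μ y₁ y₂ y₃ z) :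
    thetaFactor μ * logDeriv (fun x => y₃ x - y₂ x) z = (constB μ + constC μ - 2) * y₁ z
      + (constA μ + constC μ - 1) * y₂ z + (constA μ + constB μ - 1) * y₃ z := by
  have h₂ := h.eqn₂
  have h₃ := h.eqn₃
  rw [theta_eq] at h₂ h₃
  rw [logDeriv_apply, deriv_fun_sub h.diff₃ h.diff₂, mul_div, div_eq_iff h.ne₃₂]
  linear_combination h₃ - h₂

lemma logDeriv_sub₁₂ (h : IsRegularPoint μ y₁ y₂ y₃ z) :
    thetaFactor μ * logDeriv (fun x => y₁ x - y₂ x) z = (constB μ + constC μ - 1) * y₁ z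
      + (constA μ + constC μ - 1) * y₂ z + (constA μ + constB μ - 2) * y₃ z := by
  have h₁ := h.eqn₁
  have h₂ := h.eqn₂
  rw [theta_eq] at h₁ h₂
  rw [logDeriv_apply, deriv_fun_sub h.diff₁ h.diff₂, mul_div, div_eq_iff h.ne₁₂]
  linear_combination h₁ - h₂

lemma logDeriv_ratio (h : IsRegularPoint μ y₁ y₂ y₃ z) :
    thetaFactor μ * logDeriv (fun x => (y₃ x - y₂ x) / (y₃ x - y₁ x)) z = y₂ z - y₁ z := by
  rw [logDeriv_div z h.ne₃₂ h.ne₃₁ (h.diff₃.fun_sub h.diff₂) (h.diff₃.fun_sub h.diff₁), mul_sub,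
    h.logDeriv_sub₃₁, h.logDeriv_sub₃₂]
  ring

lemma logDeriv_ratio_sub_one (h : IsRegularPoint μ y₁ y₂ y₃ z) :
    thetaFactor μ * logDeriv (fun x => (y₁ x - y₂ x) / (y₃ x - y₁ x)) z = y₂ z - y₃ z := by
  rw [logDeriv_div z h.ne₁₂ h.ne₃₁ (h.diff₁.fun_sub h.diff₂) (h.diff₃.fun_sub h.diff₁), mul_sub,
    h.logDeriv_sub₃₁, h.logDeriv_sub₁₂]
  ring

lemma theta_scaledE2 (h : IsRegularPoint μ y₁ y₂ y₃ z) :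
    theta μ (scaledE2 μ y₁ y₂ y₃) z =
      scaledE2 μ y₁ y₂ y₃ z ^ 2 - constB μ ^ 2 * ((y₂ z - y₁ z) * (y₂ z - y₃ z)) := by
  have hderiv : HasDerivAt (scaledE2 μ y₁ y₂ y₃) ((constB μ - constA μ) * deriv y₁ z
      - constB μ * deriv y₂ z + (constB μ + constA μ - 1) * deriv y₃ z) z :=
    ((h.diff₁.hasDerivAt.const_mul _).sub (h.diff₂.hasDerivAt.const_mul _)).add
      (h.diff₃.hasDerivAt.const_mul _)
  have htheta : theta μ (scaledE2 μ y₁ y₂ y₃) z = (constB μ - constA μ) * theta μ y₁ z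
      - constB μ * theta μ y₂ z + (constB μ + constA μ - 1) * theta μ y₃ z := by
    simp only [theta_eq, hderiv.deriv]
    ring
  rw [htheta, h.eqn₁, h.eqn₂, h.eqn₃]
  unfold scaledE2 constA constB constC
  ring

end IsRegularPoint

/-- The function whose normal form is the discriminant. With `l = lcm (2, μ)`, so that `δ = 2 l`,
the exponents for even and odd `μ` are uniformly `l`, `l / μ` and `l / 2`. -/
def rawDiscriminant (μ : ℕ) (J : ℂ → ℂ) (z : ℂ) : ℂ :=
  weightTwo μ J z ^ Nat.lcm 2 μ * J z ^ (Nat.lcm 2 μ / μ) * (J z - 1) ^ (Nat.lcm 2 μ / 2)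

lemma discriminant_eq (hμ : μ ≠ 0) (J : ℂ → ℂ) (z : ℍ) :
    discriminant μ J z = toMeromorphicNFOn (rawDiscriminant μ J) upperHalfPlaneSet z := by
  have hpos : 0 < μ := Nat.pos_of_ne_zero hμ
  unfold discriminant rawDiscriminant weightTwo
  congr 2
  funext x
  split_ifs with hpar
  · simp [Nat.lcm_eq_right hpar.two_dvd, Nat.div_self hpos]
  · have hlcm : Nat.lcm 2 μ = 2 * μ :=
      ((Nat.coprime_two_left.2 (Nat.not_even_iff_odd.1 hpar))).lcm_eq_mul
    simp [hlcm, hpos]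

lemma delta_ne_zero (hμ : μ ≠ 0) : delta μ ≠ 0 :=
  mul_ne_zero two_ne_zero (Nat.lcm_ne_zero two_ne_zero hμ)

lemma cast_lcm_two_div {d : ℕ} (hμ : μ ≠ 0) (hd : d ∣ Nat.lcm 2 μ) :
    ((Nat.lcm 2 μ / d : ℕ) : ℂ) = delta μ * (1 / (2 * d)) := by
  have hd0 : (d : ℂ) ≠ 0 := by
    exact_mod_cast ne_zero_of_dvd_ne_zero (Nat.lcm_ne_zero two_ne_zero hμ) hd
  rw [Nat.cast_div hd hd0, delta]
  push_cast
  field_simp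

variable {x : ℂ}

lemma meromorphicAt_hauptmodul (y₁ y₂ y₃ : ℂ → ℂ) (hx : x ∈ upperHalfPlaneSet) :
    MeromorphicAt (hauptmodul y₁ y₂ y₃) x :=
  (meromorphicNFOn_toMeromorphicNFOn _ _ hx).meromorphicAt

lemma meromorphicAt_weightTwo {J : ℂ → ℂ} (hJ : MeromorphicAt J x) :
    MeromorphicAt (weightTwo μ J) x :=
  ((MeromorphicAt.const (thetaFactor μ) x).mul hJ.deriv).div
    (hJ.mul (hJ.sub (MeromorphicAt.const 1 x)))

lemma meromorphicAt_rawDiscriminant {J : ℂ → ℂ} (hJ : MeromorphicAt J x) :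
    MeromorphicAt (rawDiscriminant μ J) x :=
  (((meromorphicAt_weightTwo hJ).fun_pow _).fun_mul (hJ.fun_pow _)).fun_mul
    ((hJ.fun_sub (MeromorphicAt.const 1 x)).fun_pow _)

lemma meromorphicOn_rawDiscriminant (y₁ y₂ y₃ : ℂ → ℂ) :
    MeromorphicOn (rawDiscriminant μ (hauptmodul y₁ y₂ y₃)) upperHalfPlaneSet :=
  fun _ hx => meromorphicAt_rawDiscriminant (meromorphicAt_hauptmodul y₁ y₂ y₃ hx)

lemma meromorphicOrderAt_weightTwo_add_sub_one {J : ℂ → ℂ} (hμ : 3 ≤ μ) (hJ : MeromorphicAt J x)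
    (hne : ∀ᶠ z in 𝓝[≠] x, J z - 1 ≠ 0) :
    meromorphicOrderAt (weightTwo μ J) x + meromorphicOrderAt (fun z => J z - 1) x =
      meromorphicOrderAt (logDeriv J) x := by
  rw [← meromorphicOrderAt_mul (meromorphicAt_weightTwo hJ) (hJ.fun_sub (MeromorphicAt.const 1 x)),
    ← meromorphicOrderAt_mul_of_ne_zero (f := logDeriv J) (g := fun _ => thetaFactor μ)
      analyticAt_const (thetaFactor_ne_zero hμ)]
  refine meromorphicOrderAt_congr ?_
  filter_upwards [hne] with z hz
  simp only [Pi.mul_apply, weightTwo, theta_eq, logDeriv_apply]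
  field_simp

lemma meromorphicOrderAt_weightTwo_add {J : ℂ → ℂ} (hμ : 3 ≤ μ) (hJ : MeromorphicAt J x)
    (hne : ∀ᶠ z in 𝓝[≠] x, J z ≠ 0) :
    meromorphicOrderAt (weightTwo μ J) x + meromorphicOrderAt J x =
      meromorphicOrderAt (logDeriv fun z => J z - 1) x := by
  rw [← meromorphicOrderAt_mul (meromorphicAt_weightTwo hJ) hJ,
    ← meromorphicOrderAt_mul_of_ne_zero (f := logDeriv fun z => J z - 1)
      (g := fun _ => thetaFactor μ) analyticAt_const (thetaFactor_ne_zero hμ)]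
  refine meromorphicOrderAt_congr ?_
  filter_upwards [hne] with z hz
  simp only [Pi.mul_apply, weightTwo, theta_eq, logDeriv_apply, deriv_sub_const]
  field_simp

lemma exists_orders {J : ℂ → ℂ} (hμ : 3 ≤ μ) (hJ : MeromorphicAt J x)
    (hne : ∀ᶠ z in 𝓝[≠] x, weightTwo μ J z ≠ 0 ∧ J z ≠ 0 ∧ J z - 1 ≠ 0) :
    ∃ a p s : ℤ, meromorphicOrderAt (weightTwo μ J) x = a ∧ meromorphicOrderAt J x = p ∧
      meromorphicOrderAt (fun z => J z - 1) x = s ∧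
      -1 ≤ a + s ∧ -1 ≤ a + p ∧ (p ≠ 0 → a + s = -1) ∧ (s ≠ 0 → a + p = -1) := by
  have hJ1 : MeromorphicAt (fun z => J z - 1) x := hJ.fun_sub (MeromorphicAt.const 1 x)
  have hX_top := (meromorphicOrderAt_ne_top_iff_eventually_ne_zero
    (meromorphicAt_weightTwo hJ)).2 (hne.mono fun _ h => h.1)
  have hJ_top :=
    (meromorphicOrderAt_ne_top_iff_eventually_ne_zero hJ).2 (hne.mono fun _ h => h.2.1)
  have hJ1_top :=
    (meromorphicOrderAt_ne_top_iff_eventually_ne_zero hJ1).2 (hne.mono fun _ h => h.2.2)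
  have hadd := meromorphicOrderAt_weightTwo_add hμ hJ (hne.mono fun _ h => h.2.1)
  have hadd_sub_one :=
    meromorphicOrderAt_weightTwo_add_sub_one hμ hJ (hne.mono fun _ h => h.2.2)
  have has := neg_one_le_meromorphicOrderAt_logDeriv hJ hJ_top
  have hap := neg_one_le_meromorphicOrderAt_logDeriv hJ1 hJ1_top
  have hp := fun h => meromorphicOrderAt_logDeriv_eq_neg_one hJ h hJ_top
  have hs := fun h => meromorphicOrderAt_logDeriv_eq_neg_one hJ1 h hJ1_top
  rw [← hadd_sub_one] at has hp
  rw [← hadd] at hap hs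
  lift meromorphicOrderAt (weightTwo μ J) x to ℤ using hX_top with a
  lift meromorphicOrderAt J x to ℤ using hJ_top with p
  lift meromorphicOrderAt (fun z => J z - 1) x to ℤ using hJ1_top with s
  exact ⟨a, p, s, rfl, rfl, rfl, WithTop.coe_le_coe.1 has, WithTop.coe_le_coe.1 hap,
    fun h => WithTop.coe_inj.1 (hp (WithTop.coe_ne_zero.2 h)),
    fun h => WithTop.coe_inj.1 (hs (WithTop.coe_ne_zero.2 h))⟩

namespace IsDarbouxHalphen

lemma hauptmodul_eventuallyEq (hy : IsDarbouxHalphen μ y₁ y₂ y₃) (hx : x ∈ upperHalfPlaneSet) :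
    hauptmodul y₁ y₂ y₃ =ᶠ[𝓝[≠] x] fun z => (y₃ z - y₂ z) / (y₃ z - y₁ z) :=
  MeromorphicOn.toMeromorphicNFOn_eq_self_on_nhdsNE (fun z hz =>
    ((hy.mero₃ z hz).sub (hy.mero₂ z hz)).div ((hy.mero₃ z hz).sub (hy.mero₁ z hz))) hx

lemma eventually_isRegularPoint (hy : IsDarbouxHalphen μ y₁ y₂ y₃)
    (hJ : (hauptmodul y₁ y₂ y₃ '' upperHalfPlaneSet).Nontrivial) (hx : x ∈ upperHalfPlaneSet) :
    ∀ᶠ z in 𝓝[≠] x, IsRegularPoint μ y₁ y₂ y₃ z := by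
  have hne (c : ℂ) : ∀ᶠ z in 𝓝[≠] x, hauptmodul y₁ y₂ y₃ z - c ≠ 0 :=
    (meromorphicOrderAt_ne_top_iff_eventually_ne_zero
      ((meromorphicAt_hauptmodul y₁ y₂ y₃ hx).sub (MeromorphicAt.const c x))).1
      (meromorphicOrderAt_sub_const_ne_top (meromorphicNFOn_toMeromorphicNFOn _ _)
        isPreconnected_upperHalfPlaneSet hJ hx c)
  have hU := isOpen_upperHalfPlaneSet.mem_nhds hx
  filter_upwards [hne 0, hne 1, hy.hauptmodul_eventuallyEq hx,
    eventually_nhdsNE_of_eventually_codiscreteWithin hy.eqn₁ hU,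
    eventually_nhdsNE_of_eventually_codiscreteWithin hy.eqn₂ hU,
    eventually_nhdsNE_of_eventually_codiscreteWithin hy.eqn₃ hU,
    (hy.mero₁ x hx).eventually_analyticAt, (hy.mero₂ x hx).eventually_analyticAt,
    (hy.mero₃ x hx).eventually_analyticAt] with z h0 h1 hJz e₁ e₂ e₃ a₁ a₂ a₃
  rw [hJz, sub_zero] at h0
  rw [hJz] at h1
  obtain ⟨h32, h31⟩ := div_ne_zero_iff.1 h0
  refine ⟨a₁.differentiableAt, a₂.differentiableAt, a₃.differentiableAt, e₁, e₂, e₃, ?_, h31, h32⟩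
  contrapose! h1
  rw [sub_eq_zero, div_eq_one_iff_eq h31]
  linear_combination h1

lemma hauptmodul_sub_one_eventuallyEq (hy : IsDarbouxHalphen μ y₁ y₂ y₃)
    (hJ : (hauptmodul y₁ y₂ y₃ '' upperHalfPlaneSet).Nontrivial) (hx : x ∈ upperHalfPlaneSet) :
    (fun z => hauptmodul y₁ y₂ y₃ z - 1) =ᶠ[𝓝[≠] x]
      fun z => (y₁ z - y₂ z) / (y₃ z - y₁ z) := by
  filter_upwards [hy.hauptmodul_eventuallyEq hx, hy.eventually_isRegularPoint hJ hx] with z hz hreg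
  rw [hz, div_sub_one hreg.ne₃₁, sub_sub_sub_cancel_left]

lemma logDeriv_hauptmodul (hy : IsDarbouxHalphen μ y₁ y₂ y₃)
    (hJ : (hauptmodul y₁ y₂ y₃ '' upperHalfPlaneSet).Nontrivial) (hx : x ∈ upperHalfPlaneSet) :
    ∀ᶠ z in 𝓝[≠] x, thetaFactor μ * logDeriv (hauptmodul y₁ y₂ y₃) z = y₂ z - y₁ z := by
  filter_upwards [logDeriv_congr_nhdsNE (hy.hauptmodul_eventuallyEq hx),
    hy.eventually_isRegularPoint hJ hx] with z hz hreg
  rw [hz, hreg.logDeriv_ratio]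

lemma logDeriv_hauptmodul_sub_one (hy : IsDarbouxHalphen μ y₁ y₂ y₃)
    (hJ : (hauptmodul y₁ y₂ y₃ '' upperHalfPlaneSet).Nontrivial) (hx : x ∈ upperHalfPlaneSet) :
    ∀ᶠ z in 𝓝[≠] x,
      thetaFactor μ * logDeriv (fun u => hauptmodul y₁ y₂ y₃ u - 1) z = y₂ z - y₃ z := by
  filter_upwards [logDeriv_congr_nhdsNE (hy.hauptmodul_sub_one_eventuallyEq hJ hx),
    hy.eventually_isRegularPoint hJ hx] with z hz hreg
  rw [hz, hreg.logDeriv_ratio_sub_one]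

lemma weightTwo_eventuallyEq (hy : IsDarbouxHalphen μ y₁ y₂ y₃)
    (hJ : (hauptmodul y₁ y₂ y₃ '' upperHalfPlaneSet).Nontrivial) (hx : x ∈ upperHalfPlaneSet) :
    weightTwo μ (hauptmodul y₁ y₂ y₃) =ᶠ[𝓝[≠] x] fun z => -1 * (y₃ z - y₁ z) := by
  filter_upwards [hy.logDeriv_hauptmodul hJ hx, hy.hauptmodul_sub_one_eventuallyEq hJ hx,
    hy.eventually_isRegularPoint hJ hx] with z hlog hJ1 hreg
  have h12 := hreg.ne₁₂
  have h31 := hreg.ne₃₁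
  rw [weightTwo, theta_eq, ← div_div, mul_div_assoc, ← logDeriv_apply, hlog, hJ1]
  field_simp
  ring

lemma eventually_ne_zero (hy : IsDarbouxHalphen μ y₁ y₂ y₃)
    (hJ : (hauptmodul y₁ y₂ y₃ '' upperHalfPlaneSet).Nontrivial) (hx : x ∈ upperHalfPlaneSet) :
    ∀ᶠ z in 𝓝[≠] x, weightTwo μ (hauptmodul y₁ y₂ y₃) z ≠ 0 ∧ hauptmodul y₁ y₂ y₃ z ≠ 0 ∧
      hauptmodul y₁ y₂ y₃ z - 1 ≠ 0 := by
  filter_upwards [hy.eventually_isRegularPoint hJ hx, hy.hauptmodul_eventuallyEq hx,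
    hy.hauptmodul_sub_one_eventuallyEq hJ hx, hy.weightTwo_eventuallyEq hJ hx]
    with z hreg hJz hJ1z hXz
  exact ⟨hXz ▸ mul_ne_zero (by norm_num) hreg.ne₃₁, hJz ▸ div_ne_zero hreg.ne₃₂ hreg.ne₃₁,
    hJ1z ▸ div_ne_zero hreg.ne₁₂ hreg.ne₃₁⟩

lemma logDeriv_weightTwo (hy : IsDarbouxHalphen μ y₁ y₂ y₃)
    (hJ : (hauptmodul y₁ y₂ y₃ '' upperHalfPlaneSet).Nontrivial) (hx : x ∈ upperHalfPlaneSet) :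
    ∀ᶠ z in 𝓝[≠] x, thetaFactor μ * logDeriv (weightTwo μ (hauptmodul y₁ y₂ y₃)) z =
      (constB μ + constC μ - 1) * y₁ z + (constA μ + constC μ - 2) * y₂ z
        + (constA μ + constB μ - 1) * y₃ z := by
  filter_upwards [logDeriv_congr_nhdsNE (hy.weightTwo_eventuallyEq hJ hx),
    hy.eventually_isRegularPoint hJ hx] with z hz hreg
  rw [hz, logDeriv_const_mul z (-1) (by norm_num), hreg.logDeriv_sub₃₁]

lemma logDeriv_rawDiscriminant (hμ : μ ≠ 0) (hy : IsDarbouxHalphen μ y₁ y₂ y₃)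
    (hJ : (hauptmodul y₁ y₂ y₃ '' upperHalfPlaneSet).Nontrivial) (hx : x ∈ upperHalfPlaneSet) :
    (fun z => thetaFactor μ * logDeriv (rawDiscriminant μ (hauptmodul y₁ y₂ y₃)) z) =ᶠ[𝓝[≠] x]
      fun z => delta μ * scaledE2 μ y₁ y₂ y₃ z := by
  have hmero := meromorphicAt_hauptmodul y₁ y₂ y₃ hx
  filter_upwards [hmero.eventually_analyticAt,
    (meromorphicAt_weightTwo (μ := μ) hmero).eventually_analyticAt,
    hy.eventually_ne_zero hJ hx, hy.logDeriv_hauptmodul hJ hx,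
    hy.logDeriv_hauptmodul_sub_one hJ hx, hy.logDeriv_weightTwo hJ hx]
    with z hJan hXan ⟨hX0, hJ0, hJ10⟩ hJlog hJ1log hXlog
  have hlcm : (Nat.lcm 2 μ : ℂ) = delta μ / 2 := by simp [delta]
  unfold rawDiscriminant
  rw [logDeriv_pow_mul_pow_mul_pow hXan.differentiableAt hJan.differentiableAt
    (hJan.differentiableAt.sub_const 1) hX0 hJ0 hJ10,
    cast_lcm_two_div hμ (Nat.dvd_lcm_right 2 μ), cast_lcm_two_div hμ (Nat.dvd_lcm_left 2 μ), hlcm]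
  unfold constA constB constC at hXlog
  unfold scaledE2 constA constB
  push_cast
  linear_combination (delta μ / 2 : ℂ) * hXlog + delta μ * (1 / (2 * (μ : ℂ))) * hJlog
    + (delta μ / 4 : ℂ) * hJ1log

lemma deriv_logDeriv_rawDiscriminant (hμ : 3 ≤ μ) (hy : IsDarbouxHalphen μ y₁ y₂ y₃)
    (hJ : (hauptmodul y₁ y₂ y₃ '' upperHalfPlaneSet).Nontrivial) (hx : x ∈ upperHalfPlaneSet) :
    ∀ᶠ z in 𝓝[≠] x, deriv (logDeriv (rawDiscriminant μ (hauptmodul y₁ y₂ y₃))) z =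
      1 / delta μ * logDeriv (rawDiscriminant μ (hauptmodul y₁ y₂ y₃)) z ^ 2
        - delta μ * constB μ ^ 2 * (logDeriv (hauptmodul y₁ y₂ y₃) z *
          logDeriv (fun u => hauptmodul y₁ y₂ y₃ u - 1) z) := by
  have hδ : (delta μ : ℂ) ≠ 0 := by exact_mod_cast delta_ne_zero (by omega)
  have hlog := hy.logDeriv_rawDiscriminant (by omega) hJ hx
  filter_upwards [hlog, hlog.nhdsNE_deriv, hy.logDeriv_hauptmodul hJ hx,
    hy.logDeriv_hauptmodul_sub_one hJ hx, hy.eventually_isRegularPoint hJ hx]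
    with z hS hdS hJlog hJ1log hreg
  have hric := hreg.theta_scaledE2
  simp only [deriv_const_mul_field'] at hdS
  rw [theta_eq, ← hJlog, ← hJ1log] at hric
  refine mul_left_cancel₀ (pow_ne_zero 2 (thetaFactor_ne_zero hμ)) ?_
  field_simp
  linear_combination (delta μ * thetaFactor μ : ℂ) * hdS + (delta μ : ℂ) ^ 2 * hric
    - (thetaFactor μ * logDeriv (rawDiscriminant μ (hauptmodul y₁ y₂ y₃)) z
      + delta μ * scaledE2 μ y₁ y₂ y₃ z) * hS

/- The indicial equation of the Riccati equation for `E₂` leaves only the order `0`. -/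
lemma meromorphicOrderAt_rawDiscriminant (hμ : 3 ≤ μ) (hy : IsDarbouxHalphen μ y₁ y₂ y₃)
    (hJ : (hauptmodul y₁ y₂ y₃ '' upperHalfPlaneSet).Nontrivial) (hx : x ∈ upperHalfPlaneSet) :
    meromorphicOrderAt (rawDiscriminant μ (hauptmodul y₁ y₂ y₃)) x = 0 := by
  have hμ0 : μ ≠ 0 := by omega
  have hδ : (delta μ : ℂ) ≠ 0 := by exact_mod_cast delta_ne_zero hμ0
  have hmJ := meromorphicAt_hauptmodul y₁ y₂ y₃ hx
  have hmJ1 := hmJ.fun_sub (MeromorphicAt.const 1 x)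
  obtain ⟨a, p, s, ha, hp, hs, has, hap, has_eq, hap_eq⟩ :=
    exists_orders hμ hmJ (hy.eventually_ne_zero hJ hx)
  have hord : meromorphicOrderAt (rawDiscriminant μ (hauptmodul y₁ y₂ y₃)) x = _ :=
    meromorphicOrderAt_pow_mul_pow_mul_pow (meromorphicAt_weightTwo hmJ) hmJ hmJ1 ha hp hs
  set M : ℤ := (Nat.lcm 2 μ : ℕ) * a + (Nat.lcm 2 μ / μ : ℕ) * p + (Nat.lcm 2 μ / 2 : ℕ) * s
    with hM
  have hMσ : (M : ℂ) = delta μ * (a / 2 + p / (2 * μ) + s / 4) := by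
    have hlcm : (Nat.lcm 2 μ : ℂ) = delta μ / 2 := by simp [delta]
    simp only [hM, Int.cast_add, Int.cast_mul, Int.cast_natCast]
    rw [cast_lcm_two_div hμ0 (Nat.dvd_lcm_right 2 μ), cast_lcm_two_div hμ0 (Nat.dvd_lcm_left 2 μ),
      hlcm]
    push_cast
    ring
  have hric := neg_order_eq_of_riccati (meromorphicAt_rawDiscriminant hmJ) hmJ hmJ1 hord hp hs
    (hy.deriv_logDeriv_rawDiscriminant hμ hJ hx)
  have hindicial : (a / 2 + p / (2 * μ) + s / 4 : ℂ) ^ 2 + (a / 2 + p / (2 * μ) + s / 4) =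
      ((μ - 2) / (4 * μ)) ^ 2 * (p * s) := by
    rw [hMσ, constB_eq hμ0] at hric
    refine mul_left_cancel₀ hδ ?_
    linear_combination -hric - (a / 2 + p / (2 * μ) + s / 4 : ℂ) ^ 2 * delta μ * mul_inv_cancel₀ hδ
  have hσ := indicialRoot_eq_zero (m := μ) (by positivity) has hap has_eq hap_eq
    (by exact_mod_cast hindicial)
  have hM0 : (M : ℂ) = 0 := by
    rw [hMσ, mul_eq_zero]
    exact Or.inr (by exact_mod_cast hσ)
  rw [hord, Int.cast_eq_zero.1 hM0, WithTop.coe_zero]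

lemma analyticAt_toMeromorphicNFOn_rawDiscriminant (hμ : 3 ≤ μ) (hy : IsDarbouxHalphen μ y₁ y₂ y₃)
    (hJ : (hauptmodul y₁ y₂ y₃ '' upperHalfPlaneSet).Nontrivial) (hx : x ∈ upperHalfPlaneSet) :
    AnalyticAt ℂ
      (toMeromorphicNFOn (rawDiscriminant μ (hauptmodul y₁ y₂ y₃)) upperHalfPlaneSet) x := by
  rw [← (meromorphicNFOn_toMeromorphicNFOn _ _ hx).meromorphicOrderAt_nonneg_iff_analyticAt,
    meromorphicOrderAt_toMeromorphicNFOn (meromorphicOn_rawDiscriminant y₁ y₂ y₃) hx,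
    hy.meromorphicOrderAt_rawDiscriminant hμ hJ hx]

lemma mdiff_discriminant (hμ : 3 ≤ μ) (hy : IsDarbouxHalphen μ y₁ y₂ y₃)
    (hJ : (hauptmodul y₁ y₂ y₃ '' upperHalfPlaneSet).Nontrivial) :
    MDiff (discriminant μ (hauptmodul y₁ y₂ y₃)) :=
  mdiff_of_differentiableAt
    (fun _ hz => (hy.analyticAt_toMeromorphicNFOn_rawDiscriminant hμ hJ hz).differentiableAt)
    (discriminant_eq (by omega) _)

lemma discriminant_ne_zero (hμ : 3 ≤ μ) (hy : IsDarbouxHalphen μ y₁ y₂ y₃)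
    (hJ : (hauptmodul y₁ y₂ y₃ '' upperHalfPlaneSet).Nontrivial) (z : ℍ) :
    discriminant μ (hauptmodul y₁ y₂ y₃) z ≠ 0 := by
  rw [discriminant_eq (by omega),
    ← (meromorphicNFOn_toMeromorphicNFOn _ upperHalfPlaneSet z.2).meromorphicOrderAt_eq_zero_iff,
    meromorphicOrderAt_toMeromorphicNFOn (meromorphicOn_rawDiscriminant y₁ y₂ y₃) z.2,
    hy.meromorphicOrderAt_rawDiscriminant hμ hJ z.2]

lemma discriminant_comp_ofComplex_eventuallyEq (hμ : μ ≠ 0) (y₁ y₂ y₃ : ℂ → ℂ) (z : ℍ) :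
    discriminant μ (hauptmodul y₁ y₂ y₃) ∘ ofComplex =ᶠ[𝓝[≠] (z : ℂ)]
      rawDiscriminant μ (hauptmodul y₁ y₂ y₃) := by
  filter_upwards [nhdsWithin_le_nhds (upperHalfPlaneSet_mem_nhds z),
    (meromorphicOn_rawDiscriminant y₁ y₂ y₃).toMeromorphicNFOn_eq_self_on_nhdsNE z.2] with u hu hrw
  lift u to ℍ using hu
  rw [Function.comp_apply, ofComplex_apply, discriminant_eq hμ, hrw]

lemma E2_eq_logDeriv_discriminant (hμ : 3 ≤ μ) (hy : IsDarbouxHalphen μ y₁ y₂ y₃)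
    (hJ : (hauptmodul y₁ y₂ y₃ '' upperHalfPlaneSet).Nontrivial) (z : ℍ) :
    E2 μ y₁ y₂ y₃ z = thetaFactor μ / (delta μ * constB μ) *
      logDeriv (discriminant μ (hauptmodul y₁ y₂ y₃) ∘ ofComplex) z := by
  have hμ0 : μ ≠ 0 := by omega
  have hδ : (delta μ : ℂ) ≠ 0 := by exact_mod_cast delta_ne_zero hμ0
  have hb := constB_ne_zero hμ
  have hmero : MeromorphicOn (fun u => 1 / constB μ * scaledE2 μ y₁ y₂ y₃ u)
      upperHalfPlaneSet := fun u hu =>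
    (MeromorphicAt.const _ u).mul ((((MeromorphicAt.const _ u).mul (hy.mero₁ u hu)).sub
      ((MeromorphicAt.const _ u).mul (hy.mero₂ u hu))).add
      ((MeromorphicAt.const _ u).mul (hy.mero₃ u hu)))
  have hΔ := analyticAt_comp_ofComplex (hy.mdiff_discriminant hμ hJ) z
  have hΔ0 : (discriminant μ (hauptmodul y₁ y₂ y₃) ∘ ofComplex) z ≠ 0 := by
    simpa using hy.discriminant_ne_zero hμ hJ z
  refine toMeromorphicNFOn_apply_eq (g := fun u => thetaFactor μ / (delta μ * constB μ) *
    logDeriv (discriminant μ (hauptmodul y₁ y₂ y₃) ∘ ofComplex) u) hmero z.2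
    (analyticAt_const.mul (hΔ.deriv.div hΔ hΔ0)) ?_
  filter_upwards [logDeriv_congr_nhdsNE (discriminant_comp_ofComplex_eventuallyEq hμ0 y₁ y₂ y₃ z),
    hy.logDeriv_rawDiscriminant hμ0 hJ z.2] with u hu hlog
  rw [hu, div_mul_eq_mul_div (thetaFactor μ), hlog, scaledE2]
  field_simp

lemma mdiff_E2 (hμ : 3 ≤ μ) (hy : IsDarbouxHalphen μ y₁ y₂ y₃)
    (hJ : (hauptmodul y₁ y₂ y₃ '' upperHalfPlaneSet).Nontrivial) : MDiff (E2 μ y₁ y₂ y₃) := by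
  refine mdiff_of_differentiableAt (F := fun u => thetaFactor μ / (delta μ * constB μ) *
    logDeriv (discriminant μ (hauptmodul y₁ y₂ y₃) ∘ ofComplex) u) (fun u hu => ?_)
    (hy.E2_eq_logDeriv_discriminant hμ hJ)
  lift u to ℍ using hu
  have hΔ := analyticAt_comp_ofComplex (hy.mdiff_discriminant hμ hJ) u
  refine (hΔ.deriv.div hΔ ?_).differentiableAt.const_mul _
  simpa using hy.discriminant_ne_zero hμ hJ u

lemma thetaH_eq_of_isLogBranch (hμ : 3 ≤ μ) (hy : IsDarbouxHalphen μ y₁ y₂ y₃)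
    (hJ : (hauptmodul y₁ y₂ y₃ '' upperHalfPlaneSet).Nontrivial) {L : ℍ → ℂ}
    (hL : IsLogBranch L (discriminant μ (hauptmodul y₁ y₂ y₃))) (z : ℍ) :
    thetaH μ L z = delta μ * constB μ * E2 μ y₁ y₂ y₃ z := by
  have hδ : (delta μ : ℂ) ≠ 0 := by exact_mod_cast delta_ne_zero (by omega)
  have hb := constB_ne_zero hμ
  rw [hy.E2_eq_logDeriv_discriminant hμ hJ, hL.logDeriv_comp_ofComplex, thetaH_eq]
  field_simp

end IsDarbouxHalphen

end DarbouxHalphen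

section Serre

variable {μ : ℕ} {E : ℍ → ℂ}

lemma mdiff_serreIter (hE : MDiff E) (k : ℤ) (n : ℕ) {f : ℍ → ℂ} (hf : MDiff f) :
    MDiff (serreIter μ E k n f) := by
  induction n with
  | zero => exact hf
  | succ n ih => exact (mdiff_thetaH μ ih).sub ((mdifferentiable_const.mul hE).mul ih)

lemma thetaH_serreIter (k : ℤ) (n : ℕ) (f : ℍ → ℂ) (z : ℍ) :
    thetaH μ (serreIter μ E k n f) z = serreIter μ E k (n + 1) f z +
      ((k + 2 * n : ℤ) : ℂ) * ((μ : ℂ) - 2) / (4 * μ) * E z * serreIter μ E k n f z :=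
  (sub_add_cancel _ _).symm

end Serre

section Companion

open Matrix

variable {R : Type*} [Semiring R] {r : ℕ}

/-- The companion matrix of an equation `y⁽ʳ⁺¹⁾ = ∑ k < r, a k * y⁽ᵏ⁾`, in which `y⁽ʳ⁾` does not
occur, as a first order system for `(y, …, y⁽ʳ⁾)`. -/
def tracelessCompanion (a : Fin r → R) : Matrix (Fin (r + 1)) (Fin (r + 1)) R :=
  .of (Fin.snoc (fun j : Fin r => Pi.single j.succ 1) (Fin.snoc a 0 : Fin (r + 1) → R))

lemma trace_tracelessCompanion (a : Fin r → R) : (tracelessCompanion a).trace = 0 := by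
  simp [trace, tracelessCompanion, Fin.sum_univ_castSucc, Fin.castSucc_lt_succ.ne]

lemma tracelessCompanion_mulVec_castSucc (a : Fin r → R) (v : Fin (r + 1) → R) (j : Fin r) :
    (tracelessCompanion a *ᵥ v) j.castSucc = v j.succ := by
  simp [tracelessCompanion, mulVec]

lemma tracelessCompanion_mulVec_last (a : Fin r → R) (v : Fin (r + 1) → R) :
    (tracelessCompanion a *ᵥ v) (Fin.last r) = ∑ k, a k * v k.castSucc := by
  simp [tracelessCompanion, mulVec, dotProduct, Fin.sum_univ_castSucc]

end Companion

section Wronskian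

open Matrix

variable {μ : ℕ} {E : ℍ → ℂ} {w : ℤ} {r : ℕ} {b : ℕ → ℍ → ℂ} {Y : Fin (r + 1) → ℍ → ℂ}

/-- The matrix `A` of the first order system `θ u = A u` satisfied by
`u = (y, ∂_(w-r) y, …, ∂_(w-r)^r y)` for every solution `y` of the equation
`∂_(w-r)^(r+1) y + ∑ j ∈ {2, …, r + 1}, b j * ∂_(w-r)^(r+1-j) y = 0`. -/
def systemMatrix (μ : ℕ) (E : ℍ → ℂ) (w : ℤ) (r : ℕ) (b : ℕ → ℍ → ℂ) (z : ℍ) :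
    Matrix (Fin (r + 1)) (Fin (r + 1)) ℂ :=
  diagonal (fun j : Fin (r + 1) =>
      ((w - r + 2 * (j : ℕ) : ℤ) : ℂ) * ((μ : ℂ) - 2) / (4 * μ) * E z) +
    tracelessCompanion fun k : Fin r => -b (r + 1 - k) z

/-- The transpose of the matrix of the Wronskian. -/
def jetMatrix (μ : ℕ) (E : ℍ → ℂ) (w : ℤ) (Y : Fin (r + 1) → ℍ → ℂ) (z : ℍ) :
    Matrix (Fin (r + 1)) (Fin (r + 1)) ℂ :=
  .of fun j i => serreIter μ E (w - r) j (Y i) z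

lemma det_jetMatrix (z : ℍ) : (jetMatrix μ E w Y z).det = wronskian μ E w r Y z :=
  det_transpose _

lemma mdiff_wronskian (hE : MDiff E) (hY : ∀ i, MDiff (Y i)) : MDiff (wronskian μ E w r Y) := by
  refine mdiff_of_differentiableAt (F := fun x => (jetMatrix μ E w Y (ofComplex x)).det)
    (fun z hz => ?_) fun z => by rw [ofComplex_apply, det_jetMatrix]
  exact (hasDerivAt_det fun j i : Fin (r + 1) => (analyticAt_comp_ofComplex
    (mdiff_serreIter hE (w - r) j (hY i)) ⟨z, hz⟩).differentiableAt.hasDerivAt).differentiableAt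

lemma sum_weights (w : ℤ) (r : ℕ) :
    ∑ j : Fin (r + 1), ((w - r + 2 * (j : ℕ) : ℤ) : ℂ) = w * (r + 1) := by
  have hgauss : ∑ j : Fin (r + 1), (j : ℂ) = r * (r + 1) / 2 := by
    rw [Fin.sum_univ_eq_sum_range (fun j => (j : ℂ)), eq_div_iff two_ne_zero, mul_comm (r : ℂ),
      ← Nat.cast_sum]
    exact_mod_cast Finset.sum_range_id_mul_two (r + 1)
  push_cast
  rw [Finset.sum_add_distrib, ← Finset.mul_sum, hgauss]
  simp only [Finset.sum_const, Finset.card_univ, Fintype.card_fin, nsmul_eq_mul]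
  push_cast
  ring

lemma trace_systemMatrix (hμ : μ ≠ 0) (z : ℍ) :
    (systemMatrix μ E w r b z).trace = w * (r + 1) * constB μ * E z := by
  rw [systemMatrix, trace_add, trace_tracelessCompanion, trace_diagonal, add_zero,
    constB_eq hμ, ← sum_weights]
  simp only [Finset.sum_mul, mul_div_assoc]

lemma analyticAt_systemMatrix (hE : MDiff E) (hb : ∀ j, MDiff (b j)) (i j : Fin (r + 1)) (z : ℍ) :
    AnalyticAt ℂ (fun x => systemMatrix μ E w r b (ofComplex x) i j) z := by
  have hdiag : AnalyticAt ℂ (fun x => diagonal (fun j : Fin (r + 1) =>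
      ((w - r + 2 * (j : ℕ) : ℤ) : ℂ) * ((μ : ℂ) - 2) / (4 * μ) * E (ofComplex x)) i j) z := by
    by_cases hij : i = j
    · simp only [hij, diagonal_apply_eq]
      exact analyticAt_const.mul (analyticAt_comp_ofComplex hE z)
    · simp only [diagonal_apply_ne _ hij]
      exact analyticAt_const
  refine hdiag.add ?_
  cases i using Fin.lastCases with
  | cast i =>
    simp only [tracelessCompanion, of_apply, Fin.snoc_castSucc]
    exact analyticAt_const
  | last =>
    simp only [tracelessCompanion, of_apply, Fin.snoc_last]
    cases j using Fin.lastCases with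
    | cast k =>
      simp only [Fin.snoc_castSucc]
      exact (analyticAt_comp_ofComplex (hb (r + 1 - k)) z).neg
    | last =>
      simp only [Fin.snoc_last]
      exact analyticAt_const

lemma thetaH_serreIter_eq_mulVec {y : ℍ → ℂ} {z : ℍ}
    (hy : serreIter μ E (w - r) (r + 1) y z
      + ∑ j ∈ Finset.Icc 2 (r + 1), b j z * serreIter μ E (w - r) (r + 1 - j) y z = 0)
    (j : Fin (r + 1)) :
    thetaH μ (serreIter μ E (w - r) j y) z =
      (systemMatrix μ E w r b z *ᵥ fun k => serreIter μ E (w - r) k y z) j := by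
  have hreflect : ∑ k : Fin r, b (r + 1 - k) z * serreIter μ E (w - r) k y z =
      ∑ j ∈ Finset.Icc 2 (r + 1), b j z * serreIter μ E (w - r) (r + 1 - j) y z := by
    have h := Finset.sum_Ico_reflect
      (fun j => b j z * serreIter μ E (w - r) (r + 1 - j) y z) 0 (m := r) (n := r + 1) (by omega)
    rw [show Finset.Icc 2 (r + 1) = Finset.Ico (r + 1 + 1 - r) (r + 1 + 1 - 0) by grind,
      ← h, Fin.sum_univ_eq_sum_range
        (fun k => b (r + 1 - k) z * serreIter μ E (w - r) k y z), Finset.range_eq_Ico]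
    refine Finset.sum_congr rfl fun k hk => ?_
    rw [Nat.sub_sub_self (by grind)]
  rw [thetaH_serreIter, systemMatrix, add_mulVec, Pi.add_apply, mulVec_diagonal, add_comm]
  congr 1
  cases j using Fin.lastCases with
  | cast j => rw [tracelessCompanion_mulVec_castSucc, Fin.val_castSucc, Fin.val_succ]
  | last =>
    simp only [tracelessCompanion_mulVec_last, Fin.val_last, Fin.val_castSucc, neg_mul,
      Finset.sum_neg_distrib]
    rw [hreflect]
    exact eq_neg_of_add_eq_zero_left hy

variable (hμ : 3 ≤ μ) (hE : MDiff E) (hY : ∀ i, MDiff (Y i))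
  (hsol : ∀ i z, serreIter μ E (w - r) (r + 1) (Y i) z
    + ∑ j ∈ Finset.Icc 2 (r + 1), b j z * serreIter μ E (w - r) (r + 1 - j) (Y i) z = 0)

include hμ hE hY hsol

lemma hasDerivAt_jetMatrix (j i : Fin (r + 1)) (z : ℍ) :
    HasDerivAt (fun x => jetMatrix μ E w Y (ofComplex x) j i)
      ((((thetaFactor μ)⁻¹ • systemMatrix μ E w r b z) * jetMatrix μ E w Y z) j i) z := by
  have hanalytic := analyticAt_comp_ofComplex (mdiff_serreIter (μ := μ) hE (w - r) j (hY i)) z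
  refine hanalytic.differentiableAt.hasDerivAt.congr_deriv (Eq.symm ?_)
  rw [Matrix.smul_mul, Matrix.smul_apply, smul_eq_mul,
    inv_mul_eq_iff_eq_mul₀ (thetaFactor_ne_zero hμ), ← thetaH_eq,
    thetaH_serreIter_eq_mulVec (hsol i z)]
  rfl

lemma thetaH_wronskian (z : ℍ) :
    thetaH μ (wronskian μ E w r Y) z =
      w * (r + 1) * constB μ * E z * wronskian μ E w r Y z := by
  have hdet := hasDerivAt_det_of_linearSystem (M := fun x => jetMatrix μ E w Y (ofComplex x))
    (A := (thetaFactor μ)⁻¹ • systemMatrix μ E w r b z) (x := z)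
    fun j i => by simpa using hasDerivAt_jetMatrix hμ hE hY hsol j i z
  have hW : wronskian μ E w r Y ∘ ofComplex = fun x => (jetMatrix μ E w Y (ofComplex x)).det :=
    funext fun x => (det_jetMatrix _).symm
  rw [thetaH_eq, hW, hdet.deriv, trace_smul, trace_systemMatrix (by omega), ofComplex_apply,
    det_jetMatrix, smul_eq_mul, mul_assoc (thetaFactor μ)⁻¹,
    mul_inv_cancel_left₀ (thetaFactor_ne_zero hμ)]

lemma wronskian_ne_zero (hb : ∀ j, MDiff (b j)) (hindep : LinearIndependent ℂ Y) (z : ℍ) :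
    wronskian μ E w r Y z ≠ 0 := by
  intro hz
  obtain ⟨c, hc, hMc⟩ := exists_mulVec_eq_zero_of_det_eq_zero
    (M := fun x => jetMatrix μ E w Y (ofComplex x))
    (A := fun x => (thetaFactor μ)⁻¹ • systemMatrix μ E w r b (ofComplex x))
    isOpen_upperHalfPlaneSet isPreconnected_upperHalfPlaneSet z.2
    (fun i j x hx => by
      lift x to ℍ using hx
      exact analyticAt_const.mul (analyticAt_systemMatrix hE hb i j x))
    (fun j i x hx => by
      lift x to ℍ using hx
      simpa using hasDerivAt_jetMatrix hμ hE hY hsol j i x)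
    (by rw [ofComplex_apply, det_jetMatrix, hz])
  refine hc (funext (Fintype.linearIndependent_iff.1 hindep c (funext fun x => ?_)))
  simpa [mulVec, dotProduct, jetMatrix, serreIter, mul_comm] using congrFun (hMc x x.2) 0

end Wronskian

lemma vertex_mem_upperHalfPlaneSet {μ : ℕ} (hμ : 3 ≤ μ) :
    -exp (-(Real.pi * I) / μ) ∈ upperHalfPlaneSet := by
  have h1 : (1 : ℝ) < μ := by exact_mod_cast (by omega : 1 < μ)
  have hexp : -((Real.pi : ℂ) * I) / μ = (-(Real.pi / μ) : ℝ) * I := by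
    push_cast
    ring
  change 0 < (-exp (-(Real.pi * I) / μ)).im
  rw [hexp, neg_im, exp_ofReal_mul_I_im, Real.sin_neg, neg_neg]
  exact Real.sin_pos_of_pos_of_lt_pi (by positivity) (div_lt_self Real.pi_pos h1)

lemma IsHeckeHalphen.nontrivial_image_hauptmodul {μ : ℕ} {y₁ y₂ y₃ : ℂ → ℂ}
    (hy : IsHeckeHalphen μ y₁ y₂ y₃) (hμ : 3 ≤ μ) :
    (hauptmodul y₁ y₂ y₃ '' upperHalfPlaneSet).Nontrivial :=
  ⟨1, ⟨I, UpperHalfPlane.I.2, hy.at_r₁⟩, 0, ⟨_, vertex_mem_upperHalfPlaneSet hμ, hy.at_r₂⟩,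
    one_ne_zero⟩

end Hecke

end

theorem mainTheorem2_general {μ : ℕ} (hμ : 3 ≤ μ) {y₁ y₂ y₃ : ℂ → ℂ}
    (hy : Hecke.IsDarbouxHalphen μ y₁ y₂ y₃)
    (hJ : (Hecke.hauptmodul y₁ y₂ y₃ '' upperHalfPlaneSet).Nontrivial)
    {w : ℤ} {r : ℕ} {b : ℕ → ℍ → ℂ} (hb : ∀ j, MDiff (b j)) {Y : Fin (r + 1) → ℍ → ℂ}
    (hY : ∀ i, MDiff (Y i))
    (hsol : ∀ i z, Hecke.serreIter μ (Hecke.E2 μ y₁ y₂ y₃) (w - r) (r + 1) (Y i) z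
      + ∑ j ∈ Finset.Icc 2 (r + 1),
        b j z * Hecke.serreIter μ (Hecke.E2 μ y₁ y₂ y₃) (w - r) (r + 1 - j) (Y i) z = 0)
    (hindep : LinearIndependent ℂ Y) :
    (∃ L : ℍ → ℂ,
      Hecke.IsLogBranch L (Hecke.discriminant μ (Hecke.hauptmodul y₁ y₂ y₃))) ∧
    ∀ L : ℍ → ℂ,
      Hecke.IsLogBranch L (Hecke.discriminant μ (Hecke.hauptmodul y₁ y₂ y₃)) →
      ∃ C : ℂ, C ≠ 0 ∧ ∀ z : ℍ,
        Hecke.wronskian μ (Hecke.E2 μ y₁ y₂ y₃) w r Y z =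
          C * Complex.exp ((w : ℂ) * (r + 1) / Hecke.delta μ * L z) := by
  have hE := hy.mdiff_E2 hμ hJ
  have hδ : (Hecke.delta μ : ℂ) ≠ 0 := by
    exact_mod_cast Hecke.delta_ne_zero (by omega)
  refine ⟨Hecke.exists_isLogBranch (hy.mdiff_discriminant hμ hJ)
    (hy.discriminant_ne_zero hμ hJ), fun L hL => ?_⟩
  refine Hecke.exists_eq_const_mul_exp hμ (Hecke.mdiff_wronskian hE hY)
    (Hecke.wronskian_ne_zero hμ hE hY hsol hb hindep) hL.1 fun z => ?_
  rw [Hecke.thetaH_wronskian hμ hE hY hsol, hy.thetaH_eq_of_isLogBranch hμ hJ hL]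
  field_simp

theorem mainTheorem2
    (μ : ℕ) (hμ : 3 ≤ μ)
    (y₁ y₂ y₃ : ℂ → ℂ) (hy : Hecke.IsHeckeHalphen μ y₁ y₂ y₃)
    (w : ℤ) (r : ℕ) (B : ∀ j : ℕ, Hecke.AutomorphicForm μ (2 * j))
    (Λ : Fin (r + 1) → ℤ) (hΛ : Antitone Λ) (hΛ_nonneg : ∀ i, 0 ≤ Λ i)
    (hΛ_roots : (Hecke.indicial μ (Hecke.E2 μ y₁ y₂ y₃) w r B).roots =
      Finset.univ.val.map fun i => (Λ i : ℂ))
    (Y : Fin (r + 1) → ℍ → ℂ)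
    (hY : Hecke.IsFundamentalSolution μ (Hecke.E2 μ y₁ y₂ y₃) w r B Y) :
    (∃ L : ℍ → ℂ,
      Hecke.IsLogBranch L (Hecke.discriminant μ (Hecke.hauptmodul y₁ y₂ y₃))) ∧
    ∀ L : ℍ → ℂ,
      Hecke.IsLogBranch L (Hecke.discriminant μ (Hecke.hauptmodul y₁ y₂ y₃)) →
      ∃ C : ℂ, C ≠ 0 ∧ ∀ z : ℍ,
        Hecke.wronskian μ (Hecke.E2 μ y₁ y₂ y₃) w r Y z =
          C * Complex.exp ((w : ℂ) * (r + 1) / Hecke.delta μ * L z) :=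
  mainTheorem2_general hμ hy.toIsDarbouxHalphen (hy.nontrivial_image_hauptmodul hμ)
    (fun j => ModularFormClass.holo (B j)) hY.holo hY.solves hY.indep
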